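/- Let $X\in\mathbb{R}^{m\times n}$ have rank $r$, let $r\le d\le\min(m,n)$, and let $\sigma_1(X)\ge\sigma_2(X)\ge\cdots\ge\sigma_{\min(m,n)}(X)\ge 0$ be its singular values. Let $\|\cdot\|$ be the Euclidean norm, $\|\cdot\|_F$ the Frobenius norm, $\|A\|_{2,1}$ the sum of the Euclidean norms of the columns of a matrix $A$, and $\|X\|_{S_p}=\big(\sum_{j=1}^{\min(m,n)}\sigma_j(X)^p\big)^{1/p}$ for $p>0$. In what follows the minima are over all $a_1,\dots,a_d\in\mathbb{R}^m$ and $b_1,\dots,b_d\in\mathbb{R}^n$ with $X=\sum_{j=1}^d a_jb_j^T$, respectively over all $A\in\mathbb{R}^{m\times d}$ and $B\in\mathbb{R}^{d\times n}$ with $AB=X$; all of them are attained. (1) We have $$\min_{X=\sum_{j=1}^d a_jb_j^T}\ \sum_{j=1}^d\big(\|a_j\|+\|b_j\|\big)=2\sum_{j=1}^r\sigma_j(X)^{1/2},$$ and for every $\alpha>0$ $$\min_{X=\sum_{j=1}^d a_jb_j^T}\ \sum_{j=1}^d\Big(\|a_j\|+\frac{\alpha}{2}\|b_j\|^2\Big)=\frac{3\alpha^{1/3}}{2}\sum_{j=1}^r\sigma_j(X)^{2/3}.$$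 (2) Consequently, the regularizers $$\mathrm{FGSR}_{1/2}(X):=\frac12\min_{AB=X}\big(\|A\|_{2,1}+\|B^T\|_{2,1}\big),\qquad \mathrm{FGSR}_{2/3}(X):=\frac{2}{3\alpha^{1/3}}\min_{AB=X}\Big(\|A\|_{2,1}+\frac{\alpha}{2}\|B\|_F^2\Big)\quad(\alpha>0)$$ satisfy $$\mathrm{FGSR}_{1/2}(X)=\sum_{j=1}^r\sigma_j(X)^{1/2}=\|X\|_{S_{1/2}}^{1/2},\qquad \mathrm{FGSR}_{2/3}(X)=\sum_{j=1}^r\sigma_j(X)^{2/3}=\|X\|_{S_{2/3}}^{2/3}.$$ In particular, they do not depend on $d$ or $\alpha$. (3) Let $X=USV^T$ be a singular value decomposition, where $U\in\mathbb{R}^{m\times d}$ and $V\in\mathbb{R}^{n\times d}$ have orthonormal columns and $S=\mathrm{diag}(\sigma_1(X),\dots,\sigma_d(X))$. Then the minimum defining $\mathrm{FGSR}_{1/2}(X)$ is attained at $A=US^{1/2}$, $B=S^{1/2}V^T$, and the minimum defining $\mathrm{FGSR}_{2/3}(X)$ with parameter $\alpha>0$ is attained at $A=\alpha^{1/3}US^{2/3}$,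 $B=\alpha^{-1/3}S^{1/3}V^T$. -/

import Mathlib

noncomputable section

namespace FGSR

/-- The singular values of a real `m × n` matrix (the square roots of the eigenvalues of `Xᵀ X`),
in decreasing order with multiplicity, indexed from `0` and continued by zeros. -/
def sigma {m n : ℕ} (X : Matrix (Fin m) (Fin n) ℝ) (j : ℕ) : ℝ :=
  (Matrix.toEuclideanLin X).singularValues j

/-- The Schatten-`p` (quasi-)norm `(∑ j, σ_j(X) ^ p) ^ (1 / p)`, the sum being over all
`min m n` singular values. -/
def schattenNorm {m n : ℕ} (p : ℝ) (X : Matrix (Fin m) (Fin n) ℝ) : ℝ :=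
  (∑ j ∈ Finset.range (min m n), sigma X j ^ p) ^ (1 / p)

/-- `‖A‖_{2,1}`: the sum of the Euclidean norms of the columns of `A`. -/
def norm21 {k l : ℕ} (A : Matrix (Fin k) (Fin l) ℝ) : ℝ :=
  ∑ j, ‖WithLp.toLp 2 (A.col j)‖

/-- The Frobenius norm. -/
def frobeniusNorm {k l : ℕ} (B : Matrix (Fin k) (Fin l) ℝ) : ℝ :=
  (Matrix.frobeniusNormedAddCommGroup (m := Fin k) (n := Fin l) (α := ℝ)).toNorm.norm B

/-- `(a, b)` is a decomposition `X = ∑ j, a_j b_jᵀ` of `X` into `d` terms. -/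
def IsDecomp {m n d : ℕ} (X : Matrix (Fin m) (Fin n) ℝ)
    (a : Fin d → EuclideanSpace ℝ (Fin m)) (b : Fin d → EuclideanSpace ℝ (Fin n)) : Prop :=
  X = ∑ j, Matrix.vecMulVec (a j) (b j)

/-- The values of `‖A‖_{2,1} + ‖Bᵀ‖_{2,1}` over the factorizations `X = A B` of inner size `d`. -/
def halfValues {m n : ℕ} (d : ℕ) (X : Matrix (Fin m) (Fin n) ℝ) : Set ℝ :=
  {t | ∃ (A : Matrix (Fin m) (Fin d) ℝ) (B : Matrix (Fin d) (Fin n) ℝ),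
    A * B = X ∧ t = norm21 A + norm21 B.transpose}

/-- The values of `‖A‖_{2,1} + (α / 2) ‖B‖_F ^ 2` over the factorizations `X = A B` of inner
size `d`. -/
def twoThirdsValues {m n : ℕ} (d : ℕ) (α : ℝ) (X : Matrix (Fin m) (Fin n) ℝ) : Set ℝ :=
  {t | ∃ (A : Matrix (Fin m) (Fin d) ℝ) (B : Matrix (Fin d) (Fin n) ℝ),
    A * B = X ∧ t = norm21 A + α / 2 * frobeniusNorm B ^ 2}

/-- The factor group-sparse regularizer `FGSR_{1/2}`. -/
def fgsrHalf {m n : ℕ} (d : ℕ) (X : Matrix (Fin m) (Fin n) ℝ) : ℝ :=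
  1 / 2 * sInf (halfValues d X)

/-- The factor group-sparse regularizer `FGSR_{2/3}`. -/
def fgsrTwoThirds {m n : ℕ} (d : ℕ) (α : ℝ) (X : Matrix (Fin m) (Fin n) ℝ) : ℝ :=
  2 / (3 * α ^ (1 / 3 : ℝ)) * sInf (twoThirdsValues d α X)

/-- `X = U S Vᵀ` is a singular value decomposition with `d` terms: `U` and `V` have orthonormal
columns and `S` is the diagonal matrix of the first `d` singular values of `X`. -/
def IsSVD {m n d : ℕ} (X : Matrix (Fin m) (Fin n) ℝ)
    (U : Matrix (Fin m) (Fin d) ℝ) (V : Matrix (Fin n) (Fin d) ℝ) : Prop :=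
  U.transpose * U = 1 ∧ V.transpose * V = 1 ∧
    X = U * Matrix.diagonal (fun j : Fin d => sigma X j) * V.transpose

end FGSR

end

/-! Everything rests on one inequality, `sum_rpow_singularValues_le`: if `X = ∑ a_j b_jᵀ` and `0 < p
≤ 1`, then `∑ σ_i ^ p ≤ ∑ (‖a_j‖ ‖b_j‖) ^ p`. Weighted AM-GM with `p = 1/2` or `p = 2/3` turns it
into the two lower bounds; a suitably scaled singular value decomposition attains them.

For the inequality, the polar part of `X` moves the `a_j` into the domain, so that the form of `|X|`
is `∑ ⟪a'_j, x⟫ ⟪b_j, x⟫`. Polarization bounds each summand by a square `⟪e_j, x⟫ ^ 2` with `‖e_j‖ ^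
2 ≤ ‖a_j‖ ‖b_j‖`, hence `|X| ≤ ∑ e_j e_jᵀ`. It remains that `tr (A ^ p)` is monotone
(`sum_rpow_le_of_forms_le`) and subadditive over rank-one terms (`sum_rpow_eigenvalues_le`); both
follow from concavity of the power, used through tangent lines. -/

namespace FGSR

open Finset
open scoped RealInnerProductSpace

/-- A concave power lies below its tangent lines. -/
lemma rpow_le_tangent {p s x : ℝ} (hp0 : 0 ≤ p) (hp1 : p ≤ 1) (hs : 0 ≤ s) (hx : 0 < x) :
    s ^ p ≤ (1 - p) * x ^ p + p * x ^ (p - 1) * s := by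
  have h := Real.geom_mean_le_arith_mean2_weighted (sub_nonneg.2 hp1) hp0 hx.le hs (by ring)
  have h2 := mul_le_mul_of_nonneg_left h (Real.rpow_nonneg hx.le (p - 1))
  have e1 : x ^ (p - 1) * x ^ (1 - p) = 1 := by
    rw [← Real.rpow_add hx]; simp
  have e2 : x ^ (p - 1) * x = x ^ p := by
    rw [← Real.rpow_add_one hx.ne']; simp
  rw [← mul_assoc, e1, one_mul] at h2
  calc s ^ p ≤ _ := h2
    _ = (1 - p) * (x ^ (p - 1) * x) + p * x ^ (p - 1) * s := by ring
    _ = _ := by rw [e2]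

/-! ### Traces of concave powers of positive semidefinite forms. -/

section Frames

variable {E ι κ : Type*} [NormedAddCommGroup E] [InnerProductSpace ℝ E] [Fintype ι] [Fintype κ]

/-- The frame operator `∑ j, e_j e_jᵀ` of a finite family is diagonalised by an orthonormal
basis. -/
lemma exists_frame_diagonalization [FiniteDimensional ℝ E] (e : κ → E) :
    ∃ (q : OrthonormalBasis (Fin (Module.finrank ℝ E)) ℝ E) (l : Fin (Module.finrank ℝ E) → ℝ),
      ∀ k x, ∑ j, ⟪e j, q k⟫ * ⟪e j, x⟫ = l k * ⟪q k, x⟫ := by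
  let T : E →ₗ[ℝ] E := ∑ j, (innerₛₗ ℝ (e j)).smulRight (e j)
  have hT : ∀ x, T x = ∑ j, ⟪e j, x⟫ • e j := fun x => by simp [T]
  have hsymm : T.IsSymmetric := fun x y => by
    simp only [hT, sum_inner, inner_sum, inner_smul_left, inner_smul_right]
    refine sum_congr rfl fun j _ => ?_
    simp only [conj_trivial, real_inner_comm (e j) x]
    ring
  refine ⟨hsymm.eigenvectorBasis rfl, hsymm.eigenvalues rfl, fun k x => ?_⟩
  have h := hsymm.apply_eigenvectorBasis rfl k
  have h2 := congrArg (fun y => ⟪y, x⟫) h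
  simpa [hT, sum_inner, inner_smul_left] using h2

/-- The eigenvalues of a frame operator, raised to a power `p ≤ 1`, sum up to at most the sum of
the corresponding powers of the eigenvalues `‖e_j‖ ^ 2` of its rank-one terms. -/
lemma sum_rpow_eigenvalues_le {p : ℝ} (hp0 : 0 < p) (hp1 : p ≤ 1) (q : OrthonormalBasis ι ℝ E)
    (l : ι → ℝ) (e : κ → E)
    (h : ∀ k x, ∑ j, ⟪e j, q k⟫ * ⟪e j, x⟫ = l k * ⟪q k, x⟫) :
    ∑ k, l k ^ p ≤ ∑ j, (‖e j‖ ^ 2) ^ p := by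
  have hdiag : ∀ k, ∑ j, ⟪e j, q k⟫ ^ 2 = l k := fun k => by
    simpa [sq] using h k (q k)
  have hl0 : ∀ k, 0 ≤ l k := fun k => hdiag k ▸ sum_nonneg fun j _ => sq_nonneg _
  have hzero : ∀ k, l k = 0 → ∀ j, ⟪e j, q k⟫ = 0 := fun k hk j => by
    have := (sum_eq_zero_iff_of_nonneg fun j _ => sq_nonneg ⟪e j, q k⟫).1
      ((hdiag k).trans hk) j (mem_univ j)
    exact pow_eq_zero_iff (two_ne_zero) |>.1 this
  have hnorm : ∀ j, ∑ k, ⟪e j, q k⟫ ^ 2 = ‖e j‖ ^ 2 := fun j => by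
    simpa using q.sum_sq_norm_inner_left (e j)
  have hmul : ∀ j k, ⟪e j, q k⟫ ^ 2 / l k * l k = ⟪e j, q k⟫ ^ 2 := fun j k => by
    by_cases hk : l k = 0
    · simp [hk, hzero k hk j]
    · field_simp
  -- With `T = ∑ i, e_i e_iᵀ`, the sum is `t = ⟪e_j, T⁺ e_j⟫`. For `y = T⁺ e_j`, `t ^ 2 = ⟪e_j, y⟫ ^
  -- 2 ≤ ⟪T y, y⟫ = t`. Division by zero being zero makes `y` the pseudoinverse image.
  have hweight : ∀ j, ∑ k, ⟪e j, q k⟫ ^ 2 / l k ≤ 1 := fun j => by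
    set t := ∑ k, ⟪e j, q k⟫ ^ 2 / l k with ht
    let y : E := ∑ k, (⟪e j, q k⟫ / l k) • q k
    have hy : ⟪e j, y⟫ = t := by
      simp only [y, inner_sum, inner_smul_right, ht]
      exact sum_congr rfl fun k _ => by ring
    have hqy : ∀ k, ⟪q k, y⟫ = ⟪e j, q k⟫ / l k := fun k => by
      classical
      simp [y, inner_sum, inner_smul_right, orthonormal_iff_ite.1 q.orthonormal]
    have hyy : ∑ i, ⟪e i, y⟫ ^ 2 = t := by
      have : ∀ i, ⟪e i, y⟫ ^ 2
          = ∑ k, (⟪e j, q k⟫ / l k) * (⟪e i, q k⟫ * ⟪e i, y⟫) := fun i => by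
        rw [sq]
        nth_rewrite 1 [show y = ∑ k, (⟪e j, q k⟫ / l k) • q k from rfl]
        simp only [inner_sum, inner_smul_right, sum_mul, mul_assoc]
      simp only [this]
      rw [sum_comm]
      simp only [← mul_sum, h, hqy, ht]
      refine sum_congr rfl fun k _ => ?_
      by_cases hk : l k = 0
      · simp [hk]
      · field_simp
    have hle : t ^ 2 ≤ t := by
      calc t ^ 2 = ⟪e j, y⟫ ^ 2 := by rw [hy]
        _ ≤ ∑ i, ⟪e i, y⟫ ^ 2 :=
          single_le_sum (f := fun i => ⟪e i, y⟫ ^ 2) (fun i _ => sq_nonneg _) (mem_univ j)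
        _ = t := hyy
    nlinarith
  -- For `l k ≠ 0` the weights `⟪e j, q k⟫ ^ 2 / l k` sum to `1` over `j`; this distributes the
  -- trace over the rank-one terms.
  have hsplit : ∀ k, l k ^ p = ∑ j, ⟪e j, q k⟫ ^ 2 / l k * l k ^ p := fun k => by
    by_cases hk : l k = 0
    · simp [hk, hp0.ne']
    · rw [← sum_mul, ← sum_div, hdiag, div_self hk, one_mul]
  rw [sum_congr rfl fun k _ => hsplit k, sum_comm]
  refine sum_le_sum fun j _ => ?_
  rcases eq_or_ne (e j) 0 with hj | hj
  · simp [hj, hp0.ne']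
  have hc : 0 < ‖e j‖ ^ 2 := by positivity
  set c := ‖e j‖ ^ 2 with hcdef
  -- The tangent is taken at `c = ‖e j‖ ^ 2`, the weighted sum of the `l k`; its constant term is
  -- nonnegative, so total weight at most `1` suffices.
  calc ∑ k, ⟪e j, q k⟫ ^ 2 / l k * l k ^ p
      ≤ ∑ k, ⟪e j, q k⟫ ^ 2 / l k * ((1 - p) * c ^ p + p * c ^ (p - 1) * l k) :=
        sum_le_sum fun k _ => mul_le_mul_of_nonneg_left
          (rpow_le_tangent hp0.le hp1 (hl0 k) hc) (div_nonneg (sq_nonneg _) (hl0 k))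
    _ = (1 - p) * c ^ p * (∑ k, ⟪e j, q k⟫ ^ 2 / l k)
          + p * c ^ (p - 1) * ∑ k, ⟪e j, q k⟫ ^ 2 / l k * l k := by
        rw [mul_sum, mul_sum, ← sum_add_distrib]
        exact sum_congr rfl fun k _ => by ring
    _ ≤ (1 - p) * c ^ p * 1 + p * c ^ (p - 1) * c := by
        simp only [hmul, hnorm]
        gcongr
        exact hweight j
    _ = (1 - p) * c ^ p + p * (c ^ (p - 1) * c) := by ring
    _ = c ^ p := by
        rw [← Real.rpow_add_one hc.ne']
        simp only [sub_add_cancel]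
        ring

/-- Monotonicity of `A ↦ tr (A ^ p)` on positive semidefinite operators, for `p ≤ 1`, in terms of
diagonalisations. -/
lemma sum_rpow_le_of_forms_le {ι' : Type*} [Fintype ι'] {p : ℝ} (hp0 : 0 < p) (hp1 : p ≤ 1)
    (z : OrthonormalBasis ι ℝ E) (q : OrthonormalBasis ι' ℝ E) (s : ι → ℝ) (l : ι' → ℝ)
    (hs : ∀ i, 0 ≤ s i) (hl : ∀ k, 0 ≤ l k) (h : ∀ k, ∑ i, s i * ⟪z i, q k⟫ ^ 2 ≤ l k) :
    ∑ i, s i ^ p ≤ ∑ k, l k ^ p := by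
  have hz : ∀ i, ∑ k, ⟪z i, q k⟫ ^ 2 = 1 := fun i => by
    simpa using q.sum_sq_norm_inner_left (z i)
  have hq : ∀ k, ∑ i, ⟪z i, q k⟫ ^ 2 = 1 := fun k => by
    simpa using z.sum_sq_norm_inner_right (q k)
  -- The weights `⟪z i, q k⟫ ^ 2` are doubly stochastic, so for each `k` this is Jensen's
  -- inequality, with the tangent taken at `l k`. At `l k = 0` there is no tangent, but there the
  -- left side vanishes.
  have hsplit : ∀ i, s i ^ p = ∑ k, ⟪z i, q k⟫ ^ 2 * s i ^ p := fun i => by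
    rw [← sum_mul, hz, one_mul]
  rw [sum_congr rfl fun i _ => hsplit i, sum_comm]
  refine sum_le_sum fun k _ => ?_
  rcases (hl k).eq_or_lt with hk | hk
  · have h0 : ∑ i, s i * ⟪z i, q k⟫ ^ 2 = 0 :=
      le_antisymm (hk ▸ h k) (sum_nonneg fun i _ => mul_nonneg (hs i) (sq_nonneg _))
    rw [← hk, Real.zero_rpow hp0.ne']
    refine (sum_eq_zero fun i _ => ?_).le
    have := (sum_eq_zero_iff_of_nonneg fun i _ =>
      mul_nonneg (hs i) (sq_nonneg ⟪z i, q k⟫)).1 h0 i (mem_univ i)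
    rcases mul_eq_zero.1 this with h1 | h1
    · simp [h1, hp0.ne']
    · simp [h1]
  · calc ∑ i, ⟪z i, q k⟫ ^ 2 * s i ^ p
        ≤ ∑ i, ⟪z i, q k⟫ ^ 2 * ((1 - p) * l k ^ p + p * l k ^ (p - 1) * s i) :=
          sum_le_sum fun i _ => mul_le_mul_of_nonneg_left
            (rpow_le_tangent hp0.le hp1 (hs i) hk) (sq_nonneg _)
      _ = (1 - p) * l k ^ p * (∑ i, ⟪z i, q k⟫ ^ 2)
            + p * l k ^ (p - 1) * ∑ i, s i * ⟪z i, q k⟫ ^ 2 := by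
          rw [mul_sum, mul_sum, ← sum_add_distrib]
          exact sum_congr rfl fun k _ => by ring
      _ ≤ (1 - p) * l k ^ p * 1 + p * l k ^ (p - 1) * l k := by
          rw [hq]
          gcongr
          exact h k
      _ = (1 - p) * l k ^ p + p * (l k ^ (p - 1) * l k) := by ring
      _ = l k ^ p := by
          rw [← Real.rpow_add_one hk.ne']
          simp only [sub_add_cancel]
          ring

/-- If the form `∑ i, s_i ⟪z_i, x⟫ ^ 2` is dominated by `∑ j, ⟪e_j, x⟫ ^ 2`, then
`∑ i, s_i ^ p ≤ ∑ j, ‖e_j‖ ^ (2 p)` for `0 < p ≤ 1`. -/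
lemma sum_rpow_le_of_forall_sum_sq_le [FiniteDimensional ℝ E] {p : ℝ} (hp0 : 0 < p) (hp1 : p ≤ 1)
    (z : OrthonormalBasis ι ℝ E) (s : ι → ℝ) (hs : ∀ i, 0 ≤ s i) (e : κ → E)
    (h : ∀ x, ∑ i, s i * ⟪z i, x⟫ ^ 2 ≤ ∑ j, ⟪e j, x⟫ ^ 2) :
    ∑ i, s i ^ p ≤ ∑ j, (‖e j‖ ^ 2) ^ p := by
  obtain ⟨q, l, hl⟩ := exists_frame_diagonalization e
  have hdiag : ∀ k, ∑ j, ⟪e j, q k⟫ ^ 2 = l k := fun k => by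
    simpa [sq] using hl k (q k)
  exact (sum_rpow_le_of_forms_le hp0 hp1 z q s l hs
    (fun k => hdiag k ▸ sum_nonneg fun j _ => sq_nonneg _)
    (fun k => (h (q k)).trans (hdiag k).le)).trans (sum_rpow_eigenvalues_le hp0 hp1 q l e hl)

/-- A rank-one form `⟪a, x⟫ ⟪b, x⟫` is dominated by a square `⟪e, x⟫ ^ 2` with
`‖e‖ ^ 2 ≤ ‖a‖ ‖b‖`. -/
lemma exists_inner_mul_inner_le_sq (a b : E) :
    ∃ e : E, ‖e‖ ^ 2 ≤ ‖a‖ * ‖b‖ ∧ ∀ x, ⟪a, x⟫ * ⟪b, x⟫ ≤ ⟪e, x⟫ ^ 2 := by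
  rcases eq_or_ne a 0 with ha | ha
  · exact ⟨0, by simp [ha], by simp [ha]⟩
  rcases eq_or_ne b 0 with hb | hb
  · exact ⟨0, by simp [hb], by simp [hb]⟩
  have ha' : 0 < ‖a‖ := norm_pos_iff.2 ha
  have hb' : 0 < ‖b‖ := norm_pos_iff.2 hb
  let u : E := (‖a‖)⁻¹ • a
  let v : E := (‖b‖)⁻¹ • b
  have hu : ‖u‖ = 1 := by simp [u, norm_smul, ha]
  have hv : ‖v‖ = 1 := by simp [v, norm_smul, hb]
  -- The normalized midpoint works because `s t ≤ ((s + t) / 2) ^ 2`.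
  refine ⟨√(‖a‖ * ‖b‖) • ((1 / 2 : ℝ) • (u + v)), ?_, fun x => ?_⟩
  · have huv : ‖u + v‖ ≤ 2 := (norm_add_le u v).trans (by rw [hu, hv]; norm_num)
    rw [norm_smul, norm_smul, mul_pow, Real.norm_eq_abs, sq_abs, Real.sq_sqrt (by positivity)]
    refine mul_le_of_le_one_right (by positivity) (pow_le_one₀ (by positivity) ?_)
    rw [Real.norm_eq_abs, abs_of_pos (by norm_num)]
    linarith
  · have h1 : ⟪a, x⟫ = ‖a‖ * ⟪u, x⟫ := by
      simp only [u, inner_smul_left, conj_trivial]; field_simp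
    have h2 : ⟪b, x⟫ = ‖b‖ * ⟪v, x⟫ := by
      simp only [v, inner_smul_left, conj_trivial]; field_simp
    have h3 : ⟪√(‖a‖ * ‖b‖) • ((1 / 2 : ℝ) • (u + v)), x⟫ ^ 2
        = ‖a‖ * ‖b‖ * ((1 / 2) * (⟪u, x⟫ + ⟪v, x⟫)) ^ 2 := by
      rw [inner_smul_left, mul_pow, conj_trivial, Real.sq_sqrt (by positivity),
        inner_smul_left, inner_add_left, conj_trivial]
    rw [h1, h2, h3]
    have : 0 ≤ ‖a‖ * ‖b‖ * (⟪u, x⟫ - ⟪v, x⟫) ^ 2 := by positivity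
    nlinarith

end Frames

/-! ### Singular systems and the rank-one bound for Schatten quasi-norms. -/

section SingularSystem

variable {E F κ : Type*} [NormedAddCommGroup E] [InnerProductSpace ℝ E] [FiniteDimensional ℝ E]
  [NormedAddCommGroup F] [InnerProductSpace ℝ F] [FiniteDimensional ℝ F] [Fintype κ]

/-- Right singular vectors `z_i` and left singular vectors `w_i` of a linear map, where `w_i = 0`
for the vanishing singular values. -/
lemma exists_singular_system (T : E →ₗ[ℝ] F) {n : ℕ} (hn : Module.finrank ℝ E = n) :
    ∃ (z : OrthonormalBasis (Fin n) ℝ E) (w : Fin n → F),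
      (∀ i, T (z i) = T.singularValues i • w i) ∧
      ∀ i j, ⟪w i, w j⟫ = if i = j then (if T.singularValues i = 0 then 0 else 1) else 0 := by
  let z := T.isSymmetric_adjoint_comp_self.eigenvectorBasis hn
  have hz : ∀ i j, ⟪T (z i), T (z j)⟫ = if i = j then T.singularValues i ^ 2 else 0 := by
    intro i j
    rw [← LinearMap.adjoint_inner_left, ← LinearMap.comp_apply,
      T.isSymmetric_adjoint_comp_self.apply_eigenvectorBasis, ← T.sq_singularValues_fin hn,
      inner_smul_left, orthonormal_iff_ite.1 z.orthonormal]
    simp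
  -- Since `0⁻¹ = 0`, this sets `w i = 0` at vanishing singular values.
  refine ⟨z, fun i => (T.singularValues i)⁻¹ • T (z i), fun i => ?_, fun i j => ?_⟩
  · by_cases hi : T.singularValues i = 0
    · have := hz i i
      simp [hi] at this
      simp [this]
    · rw [smul_smul, mul_inv_cancel₀ hi, one_smul]
  · rw [inner_smul_left, inner_smul_right, hz]
    by_cases hij : i = j
    · subst hij
      by_cases hi : T.singularValues i = 0
      · simp [hi]
      · simp [hi]; field_simp
    · simp [hij]

/-- The Schatten quasi-norms with `0 < p ≤ 1` satisfy
`‖∑ j, a_j b_jᵀ‖_p ^ p ≤ ∑ j, (‖a_j‖ ‖b_j‖) ^ p`. -/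
lemma sum_rpow_singularValues_le {p : ℝ} (hp0 : 0 < p) (hp1 : p ≤ 1) (T : E →ₗ[ℝ] F) {n : ℕ}
    (hn : Module.finrank ℝ E = n) (a : κ → F) (b : κ → E)
    (hT : ∀ x, T x = ∑ j, ⟪b j, x⟫ • a j) :
    ∑ i : Fin n, T.singularValues i ^ p ≤ ∑ j, (‖a j‖ * ‖b j‖) ^ p := by
  obtain ⟨z, w, hzw, hw⟩ := exists_singular_system T hn
  -- This is the adjoint of the partial isometry `z i ↦ w i`, applied to `a j`. It is a contraction
  -- by Bessel's inequality for the nonzero `w i`.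
  let a' : κ → E := fun j => ∑ i, ⟪w i, a j⟫ • z i
  have ha' : ∀ j, ‖a' j‖ ≤ ‖a j‖ := fun j => by
    let v : F := ∑ i, ⟪w i, a j⟫ • w i
    have h1 : ‖a' j‖ ^ 2 = ∑ i, ⟪w i, a j⟫ ^ 2 := by
      rw [← z.sum_sq_norm_inner_right]
      simp [a', inner_sum, inner_smul_right, orthonormal_iff_ite.1 z.orthonormal]
    have h2 : ⟪v, a j⟫ = ∑ i, ⟪w i, a j⟫ ^ 2 := by
      simp [v, sum_inner, inner_smul_left, sq]
    have hw0 : ∀ i : Fin n, T.singularValues i = 0 → w i = 0 := fun i hi => by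
      have := hw i i
      simpa [hi] using this
    have h3 : ⟪v, v⟫ = ∑ i, ⟪w i, a j⟫ ^ 2 := by
      simp only [v, sum_inner, inner_sum, inner_smul_left, inner_smul_right, conj_trivial, hw,
        mul_ite, mul_zero, sum_ite_eq', mem_univ, if_true]
      refine sum_congr rfl fun i _ => ?_
      by_cases hi : T.singularValues i = 0
      · simp [hi, hw0 i hi]
      · simp [hi, sq]
    have h4 : 0 ≤ ⟪a j - v, a j - v⟫ := real_inner_self_nonneg
    rw [inner_sub_left, inner_sub_right, inner_sub_right, real_inner_comm v (a j), h2, h3,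
      real_inner_self_eq_norm_sq] at h4
    exact le_of_sq_le_sq (by linarith) (norm_nonneg _)
  choose e he hex using fun j => exists_inner_mul_inner_le_sq (a' j) (b j)
  have key := sum_rpow_le_of_forall_sum_sq_le hp0 hp1 z (fun i => T.singularValues i)
    (fun i => T.singularValues_nonneg i) e fun x => by
      have hx : ∑ i : Fin n, T.singularValues i * ⟪z i, x⟫ ^ 2 = ∑ j, ⟪a' j, x⟫ * ⟪b j, x⟫ := by
        have h5 : ∀ i, ⟪w i, T x⟫ = T.singularValues i * ⟪z i, x⟫ := fun i => by
          conv_lhs => rw [← z.sum_repr' x, map_sum]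
          simp only [map_smul, hzw, inner_sum, inner_smul_right, hw]
          by_cases hi : T.singularValues i = 0
          · simp [hi]
          · simp [hi, mul_comm]
        calc ∑ i : Fin n, T.singularValues i * ⟪z i, x⟫ ^ 2 = ∑ i, ⟪z i, x⟫ * ⟪w i, T x⟫ :=
              sum_congr rfl fun i _ => by rw [h5]; ring
          _ = _ := by
            simp only [hT, inner_sum, inner_smul_right, a', sum_inner, inner_smul_left,
              conj_trivial, mul_sum, sum_mul]
            rw [sum_comm]
            exact sum_congr rfl fun j _ => sum_congr rfl fun i _ => by ring
      rw [hx]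
      exact sum_le_sum fun j _ => hex j x
  refine key.trans (sum_le_sum fun j _ => Real.rpow_le_rpow (sq_nonneg _) ?_ hp0.le)
  exact (he j).trans (mul_le_mul_of_nonneg_right (ha' j) (norm_nonneg _))

end SingularSystem

/-! ### Matrix factorizations and the lower bounds. -/

section Factorizations

variable {m n d : ℕ}

lemma sigma_nonneg (X : Matrix (Fin m) (Fin n) ℝ) (j : ℕ) : 0 ≤ sigma X j :=
  LinearMap.singularValues_nonneg _ j

lemma sigma_eq_zero_of_rank_le (X : Matrix (Fin m) (Fin n) ℝ) {j : ℕ} (hj : X.rank ≤ j) :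
    sigma X j = 0 := by
  refine (LinearMap.singularValues_eq_zero_iff_le_finrank_range _).2 ?_
  rwa [Matrix.toEuclideanLin_eq_toLin_orthonormal, ← Matrix.rank_eq_finrank_range_toLin]

lemma sum_range_sigma_rpow (X : Matrix (Fin m) (Fin n) ℝ) {p : ℝ} (hp : 0 < p) {N : ℕ}
    (hN : X.rank ≤ N) :
    ∑ j ∈ range N, sigma X j ^ p = ∑ j ∈ range X.rank, sigma X j ^ p := by
  refine (sum_subset (range_subset_range.2 hN) fun j _ hj => ?_).symm
  rw [sigma_eq_zero_of_rank_le X (by simpa using hj), Real.zero_rpow hp.ne']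

lemma sum_fin_sigma_rpow (X : Matrix (Fin m) (Fin n) ℝ) {p : ℝ} (hp : 0 < p)
    (hN : X.rank ≤ d) :
    ∑ j : Fin d, sigma X j ^ p = ∑ j ∈ range X.rank, sigma X j ^ p := by
  rw [← sum_range_sigma_rpow X hp hN, Finset.sum_range]

lemma IsDecomp.sum_sigma_rpow_le {X : Matrix (Fin m) (Fin n) ℝ}
    {a : Fin d → EuclideanSpace ℝ (Fin m)} {b : Fin d → EuclideanSpace ℝ (Fin n)}
    (h : IsDecomp X a b) {p : ℝ} (hp0 : 0 < p) (hp1 : p ≤ 1) :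
    ∑ j ∈ range X.rank, sigma X j ^ p ≤ ∑ j, (‖a j‖ * ‖b j‖) ^ p := by
  have hr : X.rank ≤ n := by simpa using X.rank_le_width
  rw [← sum_fin_sigma_rpow X hp0 hr]
  refine sum_rpow_singularValues_le hp0 hp1 (Matrix.toEuclideanLin X) finrank_euclideanSpace_fin
    a b fun x => ?_
  ext i
  have h' : X = ∑ j, Matrix.vecMulVec (a j) (b j) := h
  rw [Matrix.ofLp_toLpLin, Matrix.toLin'_apply, h', Matrix.sum_mulVec]
  simp only [Finset.sum_apply, WithLp.ofLp_sum, WithLp.ofLp_smul, Pi.smul_apply, smul_eq_mul,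
    Matrix.vecMulVec_mulVec]
  refine sum_congr rfl fun j _ => ?_
  simp [PiLp.inner_apply, dotProduct, mul_comm]

lemma mul_eq_sum_vecMulVec (A : Matrix (Fin m) (Fin d) ℝ) (B : Matrix (Fin d) (Fin n) ℝ) :
    A * B = ∑ j, Matrix.vecMulVec (A.col j) (B.row j) := by
  ext i k
  simp [Matrix.mul_apply, Matrix.sum_apply, Matrix.vecMulVec_apply]

lemma frobeniusNorm_sq (B : Matrix (Fin d) (Fin n) ℝ) :
    frobeniusNorm B ^ 2 = ∑ j, ‖WithLp.toLp 2 (B.row j)‖ ^ 2 := by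
  have h0 : 0 ≤ ∑ i, ∑ j, ‖B i j‖ ^ (2 : ℝ) :=
    sum_nonneg fun i _ => sum_nonneg fun j _ => by positivity
  rw [frobeniusNorm, Matrix.frobenius_norm_def, ← Real.sqrt_eq_rpow, Real.sq_sqrt h0]
  simp [EuclideanSpace.norm_sq_eq]

/-- The factorizations `X = A B` correspond to the decompositions of `X` into the rank-one matrices
formed by the columns of `A` and the rows of `B`. -/
lemma exists_factorization_iff (X : Matrix (Fin m) (Fin n) ℝ)
    (P : (Fin d → EuclideanSpace ℝ (Fin m)) → (Fin d → EuclideanSpace ℝ (Fin n)) → Prop) :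
    (∃ (A : Matrix (Fin m) (Fin d) ℝ) (B : Matrix (Fin d) (Fin n) ℝ), A * B = X ∧
      P (fun j => WithLp.toLp 2 (A.col j)) (fun j => WithLp.toLp 2 (B.row j))) ↔
    ∃ (a : Fin d → EuclideanSpace ℝ (Fin m)) (b : Fin d → EuclideanSpace ℝ (Fin n)),
      IsDecomp X a b ∧ P a b := by
  constructor
  · rintro ⟨A, B, rfl, h⟩
    exact ⟨_, _, mul_eq_sum_vecMulVec A B, h⟩
  · rintro ⟨a, b, h, hP⟩
    refine ⟨Matrix.of fun i j => a j i, Matrix.of fun j k => b j k, ?_, hP⟩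
    rw [mul_eq_sum_vecMulVec]
    exact h.symm

lemma halfValues_eq (X : Matrix (Fin m) (Fin n) ℝ) :
    halfValues d X = {t : ℝ | ∃ (a : Fin d → EuclideanSpace ℝ (Fin m))
      (b : Fin d → EuclideanSpace ℝ (Fin n)), IsDecomp X a b ∧ t = ∑ j, (‖a j‖ + ‖b j‖)} := by
  ext t
  rw [Set.mem_ofPred_eq, ← exists_factorization_iff X fun a b => t = ∑ j, (‖a j‖ + ‖b j‖)]
  simp only [sum_add_distrib]
  rfl

lemma twoThirdsValues_eq (X : Matrix (Fin m) (Fin n) ℝ) (α : ℝ) :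
    twoThirdsValues d α X = {t : ℝ | ∃ (a : Fin d → EuclideanSpace ℝ (Fin m))
      (b : Fin d → EuclideanSpace ℝ (Fin n)),
        IsDecomp X a b ∧ t = ∑ j, (‖a j‖ + α / 2 * ‖b j‖ ^ 2)} := by
  ext t
  rw [Set.mem_ofPred_eq,
    ← exists_factorization_iff X fun a b => t = ∑ j, (‖a j‖ + α / 2 * ‖b j‖ ^ 2)]
  simp only [sum_add_distrib, ← mul_sum, ← frobeniusNorm_sq]
  rfl

lemma two_mul_rpow_half_le {x y : ℝ} (hx : 0 ≤ x) (hy : 0 ≤ y) :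
    2 * (x * y) ^ (1 / 2 : ℝ) ≤ x + y := by
  have := Real.geom_mean_le_arith_mean2_weighted (w₁ := 1 / 2) (w₂ := 1 / 2)
    (by norm_num) (by norm_num) hx hy (by norm_num)
  rw [Real.mul_rpow hx hy]
  linarith

/-- AM-GM for `x` and `α y ^ 2` with weights `2/3` and `1/3`. Equality needs `x = α y ^ 2`, which
dictates the powers of `α` in the minimizer. -/
lemma rpow_two_thirds_le {α x y : ℝ} (hα : 0 < α) (hx : 0 ≤ x) (hy : 0 ≤ y) :
    3 * α ^ (1 / 3 : ℝ) / 2 * (x * y) ^ (2 / 3 : ℝ) ≤ x + α / 2 * y ^ 2 := by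
  have := Real.geom_mean_le_arith_mean2_weighted (w₁ := 2 / 3) (w₂ := 1 / 3)
    (by norm_num) (by norm_num) hx (mul_nonneg hα.le (sq_nonneg y)) (by norm_num)
  rw [Real.mul_rpow hα.le (sq_nonneg y), ← Real.rpow_natCast y 2, ← Real.rpow_mul hy,
    Real.rpow_natCast] at this
  norm_num at this
  rw [Real.mul_rpow hx hy]
  norm_num
  linarith

lemma le_of_mem_halfValues {X : Matrix (Fin m) (Fin n) ℝ} {t : ℝ} (ht : t ∈ halfValues d X) :
    2 * ∑ j ∈ range X.rank, sigma X j ^ (1 / 2 : ℝ) ≤ t := by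
  rw [halfValues_eq] at ht
  obtain ⟨a, b, h, rfl⟩ := ht
  refine (mul_le_mul_of_nonneg_left (h.sum_sigma_rpow_le (p := 1 / 2) (by norm_num) (by norm_num))
    zero_le_two).trans ?_
  rw [mul_sum]
  exact sum_le_sum fun j _ => two_mul_rpow_half_le (norm_nonneg _) (norm_nonneg _)

lemma le_of_mem_twoThirdsValues {X : Matrix (Fin m) (Fin n) ℝ} {α t : ℝ} (hα : 0 < α)
    (ht : t ∈ twoThirdsValues d α X) :
    3 * α ^ (1 / 3 : ℝ) / 2 * ∑ j ∈ range X.rank, sigma X j ^ (2 / 3 : ℝ) ≤ t := by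
  rw [twoThirdsValues_eq] at ht
  obtain ⟨a, b, h, rfl⟩ := ht
  refine (mul_le_mul_of_nonneg_left (h.sum_sigma_rpow_le (p := 2 / 3) (by norm_num) (by norm_num))
    (by positivity)).trans ?_
  rw [mul_sum]
  exact sum_le_sum fun j _ => rpow_two_thirds_le hα (norm_nonneg _) (norm_nonneg _)

/-! ### Decompositions attaining the bounds. -/

/-- A singular value decomposition in which the columns of `U` and `V` belonging to the vanishing
singular values are arbitrary. -/
structure IsPartialSVD (X : Matrix (Fin m) (Fin n) ℝ)
    (U : Matrix (Fin m) (Fin d) ℝ) (V : Matrix (Fin n) (Fin d) ℝ) : Prop where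
  norm_col_left (j : Fin d) : sigma X j ≠ 0 → ‖WithLp.toLp 2 (U.col j)‖ = 1
  norm_col_right (j : Fin d) : sigma X j ≠ 0 → ‖WithLp.toLp 2 (V.col j)‖ = 1
  eq_mul : X = U * Matrix.diagonal (fun j : Fin d => sigma X j) * V.transpose

lemma norm_col_eq_one {k : ℕ} {U : Matrix (Fin k) (Fin d) ℝ} (h : U.transpose * U = 1)
    (j : Fin d) : ‖WithLp.toLp 2 (U.col j)‖ = 1 := by
  have hj := congrFun (congrFun h j) j
  rw [Matrix.mul_apply, Matrix.one_apply_eq] at hj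
  rw [EuclideanSpace.norm_eq, Real.sqrt_eq_one, ← hj]
  simp [sq]

lemma IsSVD.isPartialSVD {X : Matrix (Fin m) (Fin n) ℝ} {U : Matrix (Fin m) (Fin d) ℝ}
    {V : Matrix (Fin n) (Fin d) ℝ} (h : IsSVD X U V) : IsPartialSVD X U V :=
  ⟨fun j _ => norm_col_eq_one h.1 j, fun j _ => norm_col_eq_one h.2.1 j, h.2.2⟩

/-- The singular system gives this directly: zero columns of `U` are allowed, so the left singular
vectors need no completion to an orthonormal family. -/
lemma exists_isPartialSVD (X : Matrix (Fin m) (Fin n) ℝ) (hrd : X.rank ≤ d) (hd : d ≤ n) :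
    ∃ (U : Matrix (Fin m) (Fin d) ℝ) (V : Matrix (Fin n) (Fin d) ℝ), IsPartialSVD X U V := by
  obtain ⟨z, w, hzw, hw⟩ :=
    exists_singular_system (Matrix.toEuclideanLin X) (finrank_euclideanSpace_fin (n := n))
  refine ⟨Matrix.of fun i j => w (Fin.castLE hd j) i, Matrix.of fun i j => z (Fin.castLE hd j) i,
    fun j hj => ?_, fun j _ => z.orthonormal.1 (Fin.castLE hd j), ?_⟩
  · have h1 := hw (Fin.castLE hd j) (Fin.castLE hd j)
    have hj' : (Matrix.toEuclideanLin X).singularValues j ≠ 0 := hj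
    simp only [Fin.val_castLE, hj', if_true, if_false, real_inner_self_eq_norm_sq] at h1
    exact (pow_eq_one_iff_of_nonneg (norm_nonneg _) two_ne_zero).1 h1
  · ext i k
    have hX : X i k = (Matrix.toEuclideanLin X (EuclideanSpace.single k 1)) i := by
      simp
    rw [hX, ← z.sum_repr' (EuclideanSpace.single k (1 : ℝ)), map_sum, Matrix.mul_apply]
    simp only [map_smul, hzw, WithLp.ofLp_sum, Finset.sum_apply, WithLp.ofLp_smul, Pi.smul_apply,
      smul_eq_mul, Matrix.mul_diagonal, Matrix.transpose_apply, Matrix.of_apply]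
    -- Truncating from `n` to `d` terms loses nothing, as `σ_j = 0` for `j ≥ d ≥ rank X`.
    refine (Fintype.sum_of_injective (Fin.castLE hd) (Fin.castLE_injective hd) _ _ ?_ ?_).symm
    · intro j hj
      have hdj : d ≤ j := by
        by_contra! h
        exact hj ⟨⟨j, h⟩, by ext; simp⟩
      have : (Matrix.toEuclideanLin X).singularValues j = 0 :=
        sigma_eq_zero_of_rank_le X (hrd.trans hdj)
      simp [this]
    · intro j
      simp [EuclideanSpace.inner_single_right, sigma]
      ring

lemma norm_toLp_smul {k : ℕ} {c : ℝ} (hc : 0 ≤ c) {u : Fin k → ℝ}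
    (hu : c ≠ 0 → ‖WithLp.toLp 2 u‖ = 1) : ‖WithLp.toLp 2 (c • u)‖ = c := by
  rw [WithLp.toLp_smul, norm_smul, Real.norm_eq_abs, abs_of_nonneg hc]
  by_cases h : c = 0
  · simp [h]
  · rw [hu h, mul_one]

lemma col_mul_diagonal {k : ℕ} (U : Matrix (Fin k) (Fin d) ℝ) (v : Fin d → ℝ) (j : Fin d) :
    (U * Matrix.diagonal v).col j = v j • U.col j := by
  ext i
  simp [Matrix.mul_diagonal, mul_comm]

lemma norm_col_mul_diagonal_rpow {k : ℕ} (X : Matrix (Fin m) (Fin n) ℝ)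
    {U : Matrix (Fin k) (Fin d) ℝ}
    (hU : ∀ j : Fin d, sigma X j ≠ 0 → ‖WithLp.toLp 2 (U.col j)‖ = 1) {p : ℝ} (hp : p ≠ 0)
    (j : Fin d) :
    ‖WithLp.toLp 2 ((U * Matrix.diagonal fun j : Fin d => sigma X j ^ p).col j)‖
      = sigma X j ^ p := by
  rw [col_mul_diagonal]
  refine norm_toLp_smul (Real.rpow_nonneg (sigma_nonneg X j) p) fun h => hU j fun h0 => h ?_
  rw [h0, Real.zero_rpow hp]

section Minimizers

variable {X : Matrix (Fin m) (Fin n) ℝ} {U : Matrix (Fin m) (Fin d) ℝ}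
  {V : Matrix (Fin n) (Fin d) ℝ}

lemma diagonal_rpow_mul_diagonal_rpow (X : Matrix (Fin m) (Fin n) ℝ) {p q : ℝ} (hp : 0 < p)
    (hq : 0 < q) (hpq : p + q = 1) :
    Matrix.diagonal (fun j : Fin d => sigma X j ^ p) * Matrix.diagonal (fun j : Fin d => sigma X j ^ q)
      = Matrix.diagonal (fun j : Fin d => sigma X j) := by
  rw [Matrix.diagonal_mul_diagonal]
  congr 1
  ext j
  rw [← Real.rpow_add_of_nonneg (sigma_nonneg X j) hp.le hq.le, hpq, Real.rpow_one]

lemma IsPartialSVD.mul_eq (h : IsPartialSVD X U V) {p q : ℝ} (hp : 0 < p) (hq : 0 < q)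
    (hpq : p + q = 1) :
    U * Matrix.diagonal (fun j : Fin d => sigma X j ^ p)
      * (Matrix.diagonal (fun j : Fin d => sigma X j ^ q) * V.transpose) = X := by
  rw [Matrix.mul_assoc, ← Matrix.mul_assoc (Matrix.diagonal _),
    diagonal_rpow_mul_diagonal_rpow X hp hq hpq, ← Matrix.mul_assoc, ← h.eq_mul]

lemma transpose_diagonal_mul_transpose (V : Matrix (Fin n) (Fin d) ℝ) (v : Fin d → ℝ) :
    (Matrix.diagonal v * V.transpose).transpose = V * Matrix.diagonal v := by
  simp [Matrix.transpose_mul]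

lemma IsPartialSVD.half_value (h : IsPartialSVD X U V) (hrd : X.rank ≤ d) :
    norm21 (U * Matrix.diagonal (fun j : Fin d => sigma X j ^ (1 / 2 : ℝ)))
      + norm21 (Matrix.diagonal (fun j : Fin d => sigma X j ^ (1 / 2 : ℝ))
          * V.transpose).transpose
      = 2 * ∑ j ∈ range X.rank, sigma X j ^ (1 / 2 : ℝ) := by
  rw [transpose_diagonal_mul_transpose, norm21, norm21,
    ← sum_fin_sigma_rpow X (by norm_num) hrd, two_mul]
  congr 1
  · exact sum_congr rfl fun j _ => norm_col_mul_diagonal_rpow X h.norm_col_left (by norm_num) j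
  · exact sum_congr rfl fun j _ => norm_col_mul_diagonal_rpow X h.norm_col_right (by norm_num) j

lemma IsPartialSVD.isLeast_half (h : IsPartialSVD X U V) (hrd : X.rank ≤ d) :
    IsLeast (halfValues d X) (2 * ∑ j ∈ range X.rank, sigma X j ^ (1 / 2 : ℝ)) :=
  ⟨⟨_, _, h.mul_eq (by norm_num) (by norm_num) (by norm_num), (h.half_value hrd).symm⟩,
    fun _ ht => le_of_mem_halfValues ht⟩

lemma norm21_smul {k : ℕ} {c : ℝ} (hc : 0 ≤ c) (A : Matrix (Fin k) (Fin d) ℝ) :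
    norm21 (c • A) = c * norm21 A := by
  rw [norm21, norm21, mul_sum]
  refine sum_congr rfl fun j _ => ?_
  rw [show (c • A).col j = c • A.col j from rfl, WithLp.toLp_smul, norm_smul, Real.norm_eq_abs,
    abs_of_nonneg hc]

lemma frobeniusNorm_smul_sq (c : ℝ) (B : Matrix (Fin d) (Fin n) ℝ) :
    frobeniusNorm (c • B) ^ 2 = c ^ 2 * frobeniusNorm B ^ 2 := by
  rw [frobeniusNorm_sq, frobeniusNorm_sq, mul_sum]
  refine sum_congr rfl fun j _ => ?_
  rw [show (c • B).row j = c • B.row j from rfl, WithLp.toLp_smul, norm_smul, mul_pow,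
    Real.norm_eq_abs, sq_abs]

lemma IsPartialSVD.twoThirds_value (h : IsPartialSVD X U V) (hrd : X.rank ≤ d) {α : ℝ}
    (hα : 0 < α) :
    norm21 (α ^ (1 / 3 : ℝ) •
        (U * Matrix.diagonal (fun j : Fin d => sigma X j ^ (2 / 3 : ℝ))))
      + α / 2 * frobeniusNorm (α ^ (-(1 / 3) : ℝ) •
          (Matrix.diagonal (fun j : Fin d => sigma X j ^ (1 / 3 : ℝ)) * V.transpose)) ^ 2
      = 3 * α ^ (1 / 3 : ℝ) / 2 * ∑ j ∈ range X.rank, sigma X j ^ (2 / 3 : ℝ) := by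
  have h1 : norm21 (U * Matrix.diagonal (fun j : Fin d => sigma X j ^ (2 / 3 : ℝ)))
      = ∑ j : Fin d, sigma X j ^ (2 / 3 : ℝ) :=
    sum_congr rfl fun j _ => norm_col_mul_diagonal_rpow X h.norm_col_left (by norm_num) j
  have h2 : frobeniusNorm
        (Matrix.diagonal (fun j : Fin d => sigma X j ^ (1 / 3 : ℝ)) * V.transpose) ^ 2
      = ∑ j : Fin d, sigma X j ^ (2 / 3 : ℝ) := by
    rw [frobeniusNorm_sq]
    refine sum_congr rfl fun j _ => ?_
    rw [← Matrix.col_transpose, transpose_diagonal_mul_transpose,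
      norm_col_mul_diagonal_rpow X h.norm_col_right (by norm_num), ← Real.rpow_natCast,
      ← Real.rpow_mul (sigma_nonneg X j)]
    norm_num
  -- Both summands of the objective thus scale by `α ^ (1/3)`, with coefficients `1` and `1/2`;
  -- hence the `3/2`.
  have h3 : α * (α ^ (-(1 / 3) : ℝ)) ^ 2 = α ^ (1 / 3 : ℝ) := by
    rw [← Real.rpow_natCast, ← Real.rpow_mul hα.le, ← Real.rpow_one_add' hα.le (by norm_num)]
    norm_num
  rw [norm21_smul (Real.rpow_nonneg hα.le _), frobeniusNorm_smul_sq, h1, h2,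
    sum_fin_sigma_rpow X (by norm_num) hrd, ← h3]
  ring

lemma IsPartialSVD.twoThirds_mul_eq (h : IsPartialSVD X U V) {α : ℝ} (hα : 0 < α) :
    α ^ (1 / 3 : ℝ) • (U * Matrix.diagonal (fun j : Fin d => sigma X j ^ (2 / 3 : ℝ)))
      * α ^ (-(1 / 3) : ℝ) •
          (Matrix.diagonal (fun j : Fin d => sigma X j ^ (1 / 3 : ℝ)) * V.transpose) = X := by
  rw [Matrix.smul_mul, Matrix.mul_smul, smul_smul, ← Real.rpow_add hα, add_neg_cancel,
    Real.rpow_zero, one_smul, h.mul_eq (by norm_num) (by norm_num) (by norm_num)]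

lemma IsPartialSVD.isLeast_twoThirds (h : IsPartialSVD X U V) (hrd : X.rank ≤ d) {α : ℝ}
    (hα : 0 < α) :
    IsLeast (twoThirdsValues d α X)
      (3 * α ^ (1 / 3 : ℝ) / 2 * ∑ j ∈ range X.rank, sigma X j ^ (2 / 3 : ℝ)) :=
  ⟨⟨_, _, h.twoThirds_mul_eq hα, (h.twoThirds_value hrd hα).symm⟩,
    fun _ ht => le_of_mem_twoThirdsValues hα ht⟩

end Minimizers

lemma schattenNorm_rpow (X : Matrix (Fin m) (Fin n) ℝ) {p : ℝ} (hp : 0 < p) :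
    schattenNorm p X ^ p = ∑ j ∈ range X.rank, sigma X j ^ p := by
  have hr : X.rank ≤ min m n :=
    le_min (by simpa using X.rank_le_height) (by simpa using X.rank_le_width)
  have h0 : 0 ≤ ∑ j ∈ range (min m n), sigma X j ^ p :=
    sum_nonneg fun j _ => Real.rpow_nonneg (sigma_nonneg X j) p
  rw [schattenNorm, ← Real.rpow_mul h0, one_div_mul_cancel hp.ne', Real.rpow_one,
    sum_range_sigma_rpow X hp hr]

end Factorizations

end FGSR

theorem theorem1 {m n d : ℕ} (X : Matrix (Fin m) (Fin n) ℝ)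
    (hrd : X.rank ≤ d) (hd : d ≤ min m n) :
    -- the two minima over decompositions into `d` rank-one terms
    IsLeast
      {t : ℝ | ∃ (a : Fin d → EuclideanSpace ℝ (Fin m)) (b : Fin d → EuclideanSpace ℝ (Fin n)),
        FGSR.IsDecomp X a b ∧ t = ∑ j, (‖a j‖ + ‖b j‖)}
      (2 * ∑ j ∈ Finset.range X.rank, FGSR.sigma X j ^ (1 / 2 : ℝ)) ∧
    (∀ α : ℝ, 0 < α →
      IsLeast
        {t : ℝ | ∃ (a : Fin d → EuclideanSpace ℝ (Fin m)) (b : Fin d → EuclideanSpace ℝ (Fin n)),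
          FGSR.IsDecomp X a b ∧ t = ∑ j, (‖a j‖ + α / 2 * ‖b j‖ ^ 2)}
        (3 * α ^ (1 / 3 : ℝ) / 2 * ∑ j ∈ Finset.range X.rank, FGSR.sigma X j ^ (2 / 3 : ℝ))) ∧
    -- the regularizers: the minima defining them are attained, and their values
    (sInf (FGSR.halfValues d X) ∈ FGSR.halfValues d X ∧
      FGSR.fgsrHalf d X = ∑ j ∈ Finset.range X.rank, FGSR.sigma X j ^ (1 / 2 : ℝ) ∧
      FGSR.fgsrHalf d X = FGSR.schattenNorm (1 / 2) X ^ (1 / 2 : ℝ)) ∧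
    (∀ α : ℝ, 0 < α →
      sInf (FGSR.twoThirdsValues d α X) ∈ FGSR.twoThirdsValues d α X ∧
      FGSR.fgsrTwoThirds d α X = ∑ j ∈ Finset.range X.rank, FGSR.sigma X j ^ (2 / 3 : ℝ) ∧
      FGSR.fgsrTwoThirds d α X = FGSR.schattenNorm (2 / 3) X ^ (2 / 3 : ℝ)) ∧
    -- a singular value decomposition provides minimizers
    (∀ (U : Matrix (Fin m) (Fin d) ℝ) (V : Matrix (Fin n) (Fin d) ℝ), FGSR.IsSVD X U V →
      (∃ (A : Matrix (Fin m) (Fin d) ℝ) (B : Matrix (Fin d) (Fin n) ℝ),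
        A = U * Matrix.diagonal (fun j : Fin d => FGSR.sigma X j ^ (1 / 2 : ℝ)) ∧
        B = Matrix.diagonal (fun j : Fin d => FGSR.sigma X j ^ (1 / 2 : ℝ)) * V.transpose ∧
        A * B = X ∧
        IsLeast (FGSR.halfValues d X) (FGSR.norm21 A + FGSR.norm21 B.transpose)) ∧
      (∀ α : ℝ, 0 < α →
        ∃ (A : Matrix (Fin m) (Fin d) ℝ) (B : Matrix (Fin d) (Fin n) ℝ),
        A = α ^ (1 / 3 : ℝ) •
          (U * Matrix.diagonal (fun j : Fin d => FGSR.sigma X j ^ (2 / 3 : ℝ))) ∧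
        B = α ^ (-(1 / 3) : ℝ) •
          (Matrix.diagonal (fun j : Fin d => FGSR.sigma X j ^ (1 / 3 : ℝ)) * V.transpose) ∧
        A * B = X ∧
        IsLeast (FGSR.twoThirdsValues d α X)
          (FGSR.norm21 A + α / 2 * FGSR.frobeniusNorm B ^ 2))) := by
  -- One partial decomposition settles all the minimum values; a given SVD then only has to realize
  -- the same value.
  obtain ⟨U₀, V₀, h₀⟩ := FGSR.exists_isPartialSVD X hrd (hd.trans (min_le_right m n))
  have hhalf := h₀.isLeast_half hrd
  have htwo := fun (α : ℝ) (hα : 0 < α) => h₀.isLeast_twoThirds hrd hα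
  refine ⟨FGSR.halfValues_eq X ▸ hhalf, fun α hα => FGSR.twoThirdsValues_eq X α ▸ htwo α hα,
    ?_, fun α hα => ?_, fun U V hUV => ⟨?_, fun α hα => ?_⟩⟩
  · have hval : FGSR.fgsrHalf d X = ∑ j ∈ Finset.range X.rank, FGSR.sigma X j ^ (1 / 2 : ℝ) := by
      rw [FGSR.fgsrHalf, hhalf.csInf_eq]
      ring
    exact ⟨hhalf.csInf_mem, hval, by rw [hval, FGSR.schattenNorm_rpow X (by norm_num)]⟩
  · have hval : FGSR.fgsrTwoThirds d α X
        = ∑ j ∈ Finset.range X.rank, FGSR.sigma X j ^ (2 / 3 : ℝ) := by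
      have : α ^ (1 / 3 : ℝ) ≠ 0 := (Real.rpow_pos_of_pos hα _).ne'
      rw [FGSR.fgsrTwoThirds, (htwo α hα).csInf_eq]
      field_simp
    exact ⟨(htwo α hα).csInf_mem, hval, by rw [hval, FGSR.schattenNorm_rpow X (by norm_num)]⟩
  · have h := hUV.isPartialSVD
    exact ⟨_, _, rfl, rfl, h.mul_eq (by norm_num) (by norm_num) (by norm_num),
      (h.half_value hrd).symm ▸ hhalf⟩
  · have h := hUV.isPartialSVD
    exact ⟨_, _, rfl, rfl, h.twoThirds_mul_eq hα, (h.twoThirds_value hrd hα).symm ▸ htwo α hα⟩
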